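/- Let $H\in(0,1)$ and $T\in\mathbb R$. Let $(B^H_t)_{t\in\mathbb R}$ be a fractional Brownian motion with Hurst index $H$ on a probability space $(\Omega,\mathcal A,\mathbb P)$, i.e. a centered Gaussian process with $B^H_0=0$, with almost surely continuous paths and with covariance $\mathbb E[B^H_sB^H_t]=\tfrac12\left(|s|^{2H}+|t|^{2H}-|t-s|^{2H}\right)$, and let $(W_s)_{s\ge0}$ be a standard one-dimensional Wiener process started at $T$ and independent of $B^H$. For $\omega\in\Omega$ equip the graph $\operatorname{gr}(B^H_\cdot(\omega))=\{(t,B^H_t(\omega)):t\in\mathbb R\}$ with the maximum metric $d_\infty((t,y),(t',y'))=\max(|t-t'|,|y-y'|)$, and put $\varphi_\omega(t)=(t,B^H_t(\omega))$. For a process $(M_s)_{s\ge0}$ in a metric space $X$ started at $x$, the local walk dimension at $x$ is $\dim_w(X,M;x)=\lim_{r\searrow0}\frac{\log\mathbb E[\tau(r)]}{\log r}$ (if the limit exists), where $\tau(r)=\inf\{s\ge0:d(M_s,x)\ge r\}$. Then for $\mathbb P$-almost every $\omega$ the local walk dimension of $\varphi_\omega(W)$ at $(T,B^H_T(\omega))$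 exists (the path $B^H_\cdot(\omega)$ being fixed and the expectation being taken over $W$ only) and $$\dim_w\left(\operatorname{gr}(B^H_\cdot(\omega)),\varphi_\omega(W);(T,B^H_T(\omega))\right)=\frac{2}{H}.$$ -/

import Mathlib

open MeasureTheory ProbabilityTheory Filter Topology
open scoped NNReal ENNReal

/-- Fractional Brownian motion on `ℝ` with Hurst index `H`: a centered Gaussian process, null at
time `0`, with covariance `(|s|^(2H) + |t|^(2H) - |t - s|^(2H)) / 2` and a.s. continuous paths. -/
structure IsFractionalBrownian {Ω : Type*} {mΩ : MeasurableSpace Ω}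
    (H : ℝ) (B : ℝ → Ω → ℝ) (P : Measure Ω) : Prop where
  isGaussianProcess : IsGaussianProcess B P
  zero : ∀ᵐ ω ∂P, B 0 ω = 0
  centered : ∀ t, ∫ ω, B t ω ∂P = 0
  covariance : ∀ s t,
    cov[B s, B t; P] = (|s| ^ (2 * H) + |t| ^ (2 * H) - |t - s| ^ (2 * H)) / 2
  continuous : ∀ᵐ ω ∂P, Continuous fun t => B t ω

/-- A (standard, real) Wiener process started at `x`. -/
def IsWienerFrom {Ω : Type*} {mΩ : MeasurableSpace Ω}
    (x : ℝ) (W : ℝ≥0 → Ω → ℝ) (P : Measure Ω) : Prop :=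
  IsBrownianReal (fun s ω => W s ω - x) P

/-- The graph of `f`. As a subtype of `ℝ × ℝ` it carries the restriction of the maximum metric. -/
abbrev FunGraph (f : ℝ → ℝ) : Type := {p : ℝ × ℝ // p.2 = f p.1}

/-- The natural map `x ↦ (x, f x)` onto the graph. -/
def toGraph (f : ℝ → ℝ) (x : ℝ) : FunGraph f := ⟨(x, f x), rfl⟩

/-- First exit time `inf {s ≥ 0 : M s ∉ U}` of the process `M` from `U`, with values in `[0, ∞]`. -/
noncomputable def exitTime {Ω X : Type*} (M : ℝ≥0 → Ω → X) (U : Set X) (ω : Ω) : ℝ≥0∞ :=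
  ⨅ (s : ℝ≥0) (_ : M s ω ∉ U), (s : ℝ≥0∞)

/-- The process `M`, which starts at `x` under `P`, has local walk dimension `d` at `x`:
`log E[τ(B(x,r))] / log r → d` as `r ↘ 0`. The expectation lives in `[0, ∞]`, and its logarithm
(`log 0 = -∞`, `log ∞ = ∞`) and the quotient in the extended reals. -/
structure HasLocalWalkDim {Ω X : Type*} {mΩ : MeasurableSpace Ω} [MetricSpace X]
    (M : ℝ≥0 → Ω → X) (P : Measure Ω) (x : X) (d : ℝ) : Prop where
  start : ∀ᵐ ω ∂P, M 0 ω = x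
  tendsto : Tendsto
    (fun r : ℝ => ENNReal.log (∫⁻ ω, exitTime M (Metric.ball x r) ω ∂P) / (Real.log r : EReal))
    (𝓝[>] 0) (𝓝 (d : EReal))

/-! Near `T` the path `B` moves by about `t ^ H` over a distance `t`. As `H < 1`, the vertical side
of the maximum metric dominates, so leaving a ball of radius `r` means that `W` moves by about `r ^
(1 / H)`, which takes mean time about `r ^ (2 / H)`. Only logarithmic order matters, so arbitrarily
small losses in the exponents are allowed.

Lower bound: for `β < H`, dyadic chaining gives `|B (T ± t) - B T| < t ^ β` for small `t`, so the
walk stays in the ball while `|W - T| < r ^ (1 / β)`. The same Hölder estimate for `W` at time `0`,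
with exponent `β' < 1 / 2` and on an interval of fixed length with probability at least `1 / 2`,
bounds the mean exit time below by `r ^ (1 / (β * β')) / 2`.

Upper bound: for `γ > H`, Borel–Cantelli gives `|B (T ± 2⁻ⁿ) - B T| > 2 ^ (-n * γ)` for all large
`n`. These two points per scale suffice: by continuity `W` cannot move by `2⁻ⁿ` without hitting one
of them, and its mean time to do so is `O(4⁻ⁿ)`. -/

lemma tendsto_rpow_nhdsGT_zero {x : ℝ} (hx : 0 < x) :
    Tendsto (fun r : ℝ => r ^ x) (𝓝[>] 0) (𝓝[>] 0) := by
  refine tendsto_nhdsWithin_iff.2 ⟨?_, ?_⟩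
  · have := (Real.continuousAt_rpow_const (0 : ℝ) x (Or.inr hx.le)).tendsto
    rw [Real.zero_rpow hx.ne'] at this
    exact this.mono_left nhdsWithin_le_nhds
  · filter_upwards [self_mem_nhdsWithin] with r hr using Real.rpow_pos_of_pos hr x

/-! ### Deterministic dyadic chaining. -/

/-- Chaining along the dyadic points: a continuous function whose increments over all dyadic
intervals of generation `n ≥ m` in `[0, 1]` are at most `q ^ n` varies by at most `q ^ m / (1 - q)`
on `[0, 2 ^ (-m))`. -/
lemma abs_sub_le_of_dyadic_increments {f : ℝ → ℝ} (hf : Continuous f) {q : ℝ} (hq0 : 0 ≤ q)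
    (hq1 : q < 1) {m : ℕ}
    (h : ∀ n, m ≤ n → ∀ k < 2 ^ n, |f ((k + 1 : ℕ) / 2 ^ n) - f ((k : ℕ) / 2 ^ n)| ≤ q ^ n)
    {t : ℝ} (ht0 : 0 ≤ t) (ht : t < (1 / 2) ^ m) : |f t - f 0| ≤ q ^ m / (1 - q) := by
  have hq : 0 < 1 - q := by linarith
  -- The right side is the sum of `q ^ j` over `m < j ≤ n`: refining the dyadic floor of `t` by one
  -- generation either keeps the point or crosses one interval of the new generation.
  have hstep : ∀ n, m ≤ n →
      |f ((⌊t * 2 ^ n⌋₊ : ℕ) / 2 ^ n) - f 0| ≤ (q ^ m - q ^ n) * (q / (1 - q)) := by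
    intro n hn
    induction n, hn using Nat.le_induction with
    | base =>
      have : ⌊t * 2 ^ m⌋₊ = 0 := by
        rw [Nat.floor_eq_zero]
        calc t * 2 ^ m < (1 / 2) ^ m * 2 ^ m := by gcongr
          _ = 1 := by rw [← mul_pow]; norm_num
      simp [this]
    | succ n hn ih =>
      set a := ⌊t * 2 ^ n⌋₊ with ha
      have hpos : (0 : ℝ) < 2 ^ n := by positivity
      have h1 : (a : ℝ) ≤ t * 2 ^ n := Nat.floor_le (by positivity)
      have h2 : t * 2 ^ n < a + 1 := Nat.lt_floor_add_one _
      have hcase : ⌊t * 2 ^ (n + 1)⌋₊ = 2 * a ∨ ⌊t * 2 ^ (n + 1)⌋₊ = 2 * a + 1 := by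
        have e1 : 2 * a ≤ ⌊t * 2 ^ (n + 1)⌋₊ := by
          apply Nat.le_floor; push_cast; rw [pow_succ]; linarith
        have e2 : ⌊t * 2 ^ (n + 1)⌋₊ < 2 * a + 2 := by
          rw [Nat.floor_lt (by positivity)]; push_cast; rw [pow_succ]; linarith
        omega
      have heq : ((a : ℕ) : ℝ) / 2 ^ n = ((2 * a : ℕ) : ℝ) / 2 ^ (n + 1) := by
        push_cast; rw [pow_succ]; field_simp
      have hinc : |f ((⌊t * 2 ^ (n + 1)⌋₊ : ℕ) / 2 ^ (n + 1)) - f ((a : ℕ) / 2 ^ n)|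
          ≤ q ^ (n + 1) := by
        rcases hcase with hc | hc
        · rw [hc, heq]; simp; positivity
        · rw [hc, heq]
          apply h (n + 1) (by omega)
          have hlt : (a : ℝ) < 2 ^ n := by
            have : t < 1 := ht.trans_le (pow_le_one₀ (by norm_num) (by norm_num))
            nlinarith
          have : a < 2 ^ n := by exact_mod_cast hlt
          rw [pow_succ]; omega
      calc _ ≤ |f ((⌊t * 2 ^ (n + 1)⌋₊ : ℕ) / 2 ^ (n + 1)) - f ((a : ℕ) / 2 ^ n)|
            + |f ((a : ℕ) / 2 ^ n) - f 0| := abs_sub_le _ _ _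
        _ ≤ q ^ (n + 1) + (q ^ m - q ^ n) * (q / (1 - q)) := add_le_add hinc ih
        _ = _ := by field_simp; ring
  have hlim : Tendsto (fun n : ℕ => ((⌊t * 2 ^ n⌋₊ : ℕ) : ℝ) / 2 ^ n) atTop (𝓝 t) :=
    (tendsto_nat_floor_mul_div_atTop ht0).comp
      (tendsto_pow_atTop_atTop_of_one_lt (by norm_num : (1 : ℝ) < 2))
  have hlim2 := (((hf.tendsto t).comp hlim).sub_const (f 0)).abs
  refine le_of_tendsto hlim2 ?_
  filter_upwards [eventually_ge_atTop m] with n hn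
  refine (hstep n hn).trans ?_
  have h1 : q ^ m - q ^ n ≤ q ^ m := by have := pow_nonneg hq0 n; linarith
  have h2 : q / (1 - q) ≤ 1 / (1 - q) := by gcongr
  calc (q ^ m - q ^ n) * (q / (1 - q)) ≤ q ^ m * (1 / (1 - q)) := by gcongr
    _ = _ := by ring

/-- Power form of the chaining bound. -/
lemma exists_abs_sub_lt_rpow_of_dyadic_increments {β β' : ℝ} (hβ : 0 < β') (hββ' : β < β') (m : ℕ) :
    ∃ δ : ℝ, 0 < δ ∧ ∀ f : ℝ → ℝ, Continuous f →
      (∀ n, m ≤ n → ∀ k < 2 ^ n,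
        |f ((k + 1 : ℕ) / 2 ^ n) - f ((k : ℕ) / 2 ^ n)| ≤ ((2 : ℝ) ^ (-β')) ^ n) →
      ∀ t, 0 < t → t < δ → |f t - f 0| < t ^ β := by
  set q : ℝ := (2 : ℝ) ^ (-β') with hq
  have hq0 : 0 < q := by positivity
  have hq1 : q < 1 := Real.rpow_lt_one_of_one_lt_of_neg (by norm_num) (by linarith)
  have hq' : 0 < 1 - q := by linarith
  -- Chaining is applied at a generation `k` with `2⁻ᵏ < 4 * t`, whence `4 ^ β'`; the surplus
  -- exponent `β' - β` absorbs `C` for small `t`.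
  set C : ℝ := 4 ^ β' / (1 - q) with hC
  have hC0 : 0 < C := by positivity
  have hlim : Tendsto (fun t : ℝ => t ^ (β' - β)) (𝓝[>] 0) (𝓝 0) :=
    (tendsto_rpow_nhdsGT_zero (sub_pos.2 hββ')).mono_right nhdsWithin_le_nhds
  have hev : ∀ᶠ t in 𝓝[>] (0 : ℝ), t ^ (β' - β) < 1 / C :=
    hlim.eventually (gt_mem_nhds (by positivity))
  obtain ⟨δ₀, hδ₀, hsub⟩ := (mem_nhdsGT_iff_exists_Ioo_subset).1 hev
  refine ⟨min δ₀ ((1 / 2) ^ (m + 1)), lt_min hδ₀ (by positivity), fun f hf h t ht0 ht => ?_⟩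
  have ht1 : t < δ₀ := ht.trans_le (min_le_left _ _)
  have ht2 : t < (1 / 2) ^ (m + 1) := ht.trans_le (min_le_right _ _)
  have hC1 : t ^ (β' - β) < 1 / C := hsub ⟨ht0, ht1⟩
  obtain ⟨n, hn1, hn2⟩ := exists_nat_pow_near_of_lt_one ht0
    (ht2.le.trans (pow_le_one₀ (by norm_num) (by norm_num)))
    (by norm_num : (0 : ℝ) < 1 / 2) (by norm_num)
  have hmn : m + 1 < n + 1 :=
    (pow_lt_pow_iff_right_of_lt_one₀ (by norm_num) (by norm_num)).1 (hn1.trans ht2)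
  -- Stepping back one generation turns `t ≤ 2⁻ⁿ` into the strict bound that chaining requires; the
  -- exponent `m + 1` in `δ` leaves room for this.
  obtain ⟨k, rfl⟩ : ∃ k, n = k + 1 := ⟨n - 1, by omega⟩
  have hk : t < (1 / 2) ^ k := by
    have : (0 : ℝ) < (1 / 2) ^ k := by positivity
    rw [pow_succ] at hn2; linarith
  have hb := abs_sub_le_of_dyadic_increments hf hq0.le hq1
    (fun n hn => h n (le_trans (by omega : m ≤ k) hn)) ht0.le hk
  have hqk : q ^ k ≤ 4 ^ β' * t ^ β' := by
    have e : q ^ k = ((1 / 2 : ℝ) ^ k) ^ β' := by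
      rw [hq, Real.rpow_neg (by norm_num), ← Real.inv_rpow (by norm_num), ← Real.rpow_mul_natCast
        (by norm_num), mul_comm, Real.rpow_natCast_mul (by norm_num)]
      norm_num
    rw [e, ← Real.mul_rpow (by norm_num) ht0.le]
    refine Real.rpow_le_rpow (by positivity) ?_ hβ.le
    rw [pow_succ, pow_succ] at hn1; linarith
  calc |f t - f 0| ≤ q ^ k / (1 - q) := hb
    _ ≤ 4 ^ β' * t ^ β' / (1 - q) := by gcongr
    _ = C * t ^ (β' - β) * t ^ β := by
      rw [mul_assoc, ← Real.rpow_add ht0, sub_add_cancel, hC]; ring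
    _ < C * (1 / C) * t ^ β := by gcongr
    _ = t ^ β := by field_simp

/-! ### Almost sure path estimates for Gaussian increments. -/

/-- `X` has centered Gaussian increments with standard deviation `|t - s| ^ H` on `[0, ∞)`, and
almost surely continuous paths. -/
structure HasFractionalIncrements {Ω : Type*} {mΩ : MeasurableSpace Ω}
    (H : ℝ) (X : ℝ → Ω → ℝ) (P : Measure Ω) : Prop where
  hasLaw : ∀ s t, 0 ≤ s → 0 ≤ t → HasLaw (fun ω => X t ω - X s ω)
    ((gaussianReal 0 1).map fun x => |t - s| ^ H * x) P
  continuous : ∀ᵐ ω ∂P, Continuous fun t => X t ω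

/-- Markov's inequality for the `p`-th moment. Polynomial decay of arbitrary order is enough to beat
the number `2 ^ n` of dyadic intervals. -/
lemma exists_gaussianReal_tail_le (p : ℕ) (hp : p ≠ 0) :
    ∃ C : ℝ≥0∞, C ≠ ∞ ∧ ∀ a : ℝ, 0 < a →
      gaussianReal 0 1 {x | a < |x|} ≤ C / ENNReal.ofReal a ^ p := by
  have hm : MemLp id (p : ℝ≥0∞) (gaussianReal 0 1) := memLp_id_gaussianReal' _ (by simp)
  refine ⟨eLpNorm id (p : ℝ≥0∞) (gaussianReal 0 1) ^ p, ENNReal.pow_ne_top hm.2.ne, fun a ha => ?_⟩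
  have h := mul_meas_ge_le_pow_eLpNorm' (gaussianReal 0 1) (p := (p : ℝ≥0∞)) (by simpa using hp)
    (by simp) hm.1 (ENNReal.ofReal a)
  simp only [ENNReal.toReal_natCast, ENNReal.rpow_natCast, id] at h
  rw [ENNReal.le_div_iff_mul_le (Or.inl (pow_ne_zero _ (by simpa using ha)))
    (Or.inl (ENNReal.pow_ne_top ENNReal.ofReal_ne_top)), mul_comm]
  refine le_trans ?_ h
  refine mul_le_mul_right (measure_mono fun x hx => ?_) _
  change ENNReal.ofReal a ≤ ‖x‖ₑ
  rw [Real.enorm_eq_ofReal_abs]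
  exact ENNReal.ofReal_le_ofReal (le_of_lt hx)

/-- The Gaussian density is at most `1`. -/
lemma gaussianReal_abs_le_le (a : ℝ) :
    gaussianReal 0 1 {x | |x| ≤ a} ≤ ENNReal.ofReal (2 * a) := by
  rw [gaussianReal_apply 0 one_ne_zero]
  have hs : {x : ℝ | |x| ≤ a} = Set.Icc (-a) a := by ext x; simp [abs_le]
  calc ∫⁻ x in {x | |x| ≤ a}, gaussianPDF 0 1 x ≤ ∫⁻ x in {x | |x| ≤ a}, 1 := by
        refine lintegral_mono fun x => ?_
        rw [gaussianPDF, ← ENNReal.ofReal_one]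
        refine ENNReal.ofReal_le_ofReal ?_
        rw [gaussianPDFReal]
        have h1 : (√(2 * Real.pi * (1 : ℝ≥0)))⁻¹ ≤ 1 := by
          apply inv_le_one_of_one_le₀
          rw [Real.one_le_sqrt]
          push_cast
          linarith [Real.pi_gt_three]
        have h2 : Real.exp (-(x - 0) ^ 2 / (2 * (1 : ℝ≥0))) ≤ 1 := by
          rw [Real.exp_le_one_iff]
          push_cast
          have := sq_nonneg (x - 0)
          linarith
        exact mul_le_one₀ h1 (Real.exp_pos _).le h2
    _ = ENNReal.ofReal (2 * a) := by
        rw [hs, setLIntegral_one, Real.volume_Icc]; congr 1; ring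

namespace HasFractionalIncrements

variable {Ω : Type*} {mΩ : MeasurableSpace Ω} {H : ℝ} {X : ℝ → Ω → ℝ} {P : Measure Ω}

lemma measure_increment_mem (hX : HasFractionalIncrements H X P) {s t : ℝ} (hs : 0 ≤ s)
    (ht : 0 ≤ t) {A : Set ℝ} (hA : MeasurableSet A) :
    P {ω | X t ω - X s ω ∈ A} = gaussianReal 0 1 {x | |t - s| ^ H * x ∈ A} := by
  have h := hX.hasLaw s t hs ht
  have h' := congrArg (fun μ => μ A) h.map_eq
  rw [Measure.map_apply_of_aemeasurable h.aemeasurable hA,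
    Measure.map_apply (by fun_prop) hA] at h'
  exact h'

/-- The event that all dyadic increments in `[0, 1]` of generation at least `N` are small. -/
def smallDyadic (X : ℝ → Ω → ℝ) (β : ℝ) (N : ℕ) : Set Ω :=
  {ω | ∀ n, N ≤ n → ∀ k < 2 ^ n,
    |X ((k + 1 : ℕ) / 2 ^ n) ω - X ((k : ℕ) / 2 ^ n) ω| ≤ ((2 : ℝ) ^ (-β)) ^ n}

lemma monotone_smallDyadic (β : ℝ) : Monotone (smallDyadic X β) :=
  fun _ _ h _ hω n hn => hω n (h.trans hn)

lemma nullMeasurableSet_smallDyadic (hX : HasFractionalIncrements H X P) (β : ℝ) (N : ℕ) :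
    NullMeasurableSet (smallDyadic X β N) P := by
  simp only [smallDyadic, Set.ofPred_forall]
  refine .iInter fun n => .iInter fun _ => .iInter fun k => .iInter fun _ => ?_
  have h : AEMeasurable (fun ω => X ((k + 1 : ℕ) / 2 ^ n) ω - X ((k : ℕ) / 2 ^ n) ω) P :=
    (hX.hasLaw _ _ (by positivity) (by positivity)).aemeasurable
  exact nullMeasurableSet_le h.abs aemeasurable_const

/-- An interval of length `2⁻ⁿ` has standard deviation `2 ^ (-n * H)`; dividing by it leaves a
threshold that grows geometrically when `β < H`. -/
lemma measure_dyadic_increment_gt (hX : HasFractionalIncrements H X P) {β : ℝ} (n k : ℕ) :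
    P {ω | ((2 : ℝ) ^ (-β)) ^ n < |X ((k + 1 : ℕ) / 2 ^ n) ω - X ((k : ℕ) / 2 ^ n) ω|}
      = gaussianReal 0 1 {x | ((2 : ℝ) ^ (H - β)) ^ n < |x|} := by
  have h := hX.measure_increment_mem (s := (k : ℕ) / 2 ^ n) (t := (k + 1 : ℕ) / 2 ^ n)
    (by positivity) (by positivity) (A := {x | ((2 : ℝ) ^ (-β)) ^ n < |x|})
    (measurableSet_lt measurable_const measurable_id.abs)
  simp only [Set.mem_ofPred_eq] at h
  rw [h]
  congr 1
  ext x
  have e1 : ((k + 1 : ℕ) / 2 ^ n - (k : ℕ) / 2 ^ n : ℝ) = (2 ^ n)⁻¹ := by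
    push_cast; field_simp; ring
  have e2 : |((2 : ℝ) ^ n)⁻¹| ^ H = ((2 : ℝ) ^ (-H)) ^ n := by
    rw [abs_of_pos (by positivity), Real.inv_rpow (by positivity), ← Real.rpow_natCast_mul
      (by norm_num), mul_comm, Real.rpow_mul_natCast (by norm_num), Real.rpow_neg (by norm_num),
      inv_pow]
  have e3 : ((2 : ℝ) ^ (-β)) ^ n = ((2 : ℝ) ^ (-H)) ^ n * ((2 : ℝ) ^ (H - β)) ^ n := by
    rw [← mul_pow, ← Real.rpow_add (by norm_num)]; congr 2; ring
  simp only [Set.mem_ofPred_eq]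
  rw [e1, e2, abs_mul, abs_of_pos (by positivity : (0 : ℝ) < ((2 : ℝ) ^ (-H)) ^ n), e3]
  exact mul_lt_mul_iff_right₀ (by positivity)

lemma ae_exists_mem_smallDyadic (hX : HasFractionalIncrements H X P) {β : ℝ} (hβ : β < H) :
    ∀ᵐ ω ∂P, ∃ N, ω ∈ smallDyadic X β N := by
  set ρ : ℝ := (2 : ℝ) ^ (H - β) with hρ
  have hρ1 : 1 < ρ := Real.one_lt_rpow (by norm_num) (by linarith)
  -- With `4 < ρ ^ p`, each of the `2 ^ n` intervals fails with probability at most `C / 4 ^ n`, so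
  -- the union bound is summable.
  obtain ⟨p, hp⟩ := pow_unbounded_of_one_lt 4 hρ1
  have hp0 : p ≠ 0 := by rintro rfl; norm_num at hp
  obtain ⟨C, hC, htail⟩ := exists_gaussianReal_tail_le p hp0
  let bad : ℕ → Set Ω := fun n => ⋃ k ∈ Finset.range (2 ^ n),
    {ω | ((2 : ℝ) ^ (-β)) ^ n < |X ((k + 1 : ℕ) / 2 ^ n) ω - X ((k : ℕ) / 2 ^ n) ω|}
  have hbad : ∀ n, P (bad n) ≤ C * (1 / 2) ^ n := by
    intro n
    have h4 : (4 : ℝ≥0∞) ^ n ≤ ENNReal.ofReal (ρ ^ n) ^ p := by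
      rw [ENNReal.ofReal_pow (by positivity), ← pow_mul, mul_comm, pow_mul]
      gcongr
      rw [← ENNReal.ofReal_pow (by positivity)]
      calc (4 : ℝ≥0∞) = ENNReal.ofReal 4 := by simp
        _ ≤ _ := ENNReal.ofReal_le_ofReal hp.le
    calc P (bad n) ≤ ∑ k ∈ Finset.range (2 ^ n), gaussianReal 0 1 {x | ρ ^ n < |x|} := by
          refine (measure_biUnion_finset_le _ _).trans_eq (Finset.sum_congr rfl fun k _ => ?_)
          exact hX.measure_dyadic_increment_gt n k
      _ ≤ ∑ k ∈ Finset.range (2 ^ n), C / 4 ^ n := by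
          gcongr
          exact (htail _ (by positivity)).trans (ENNReal.div_le_div_left h4 _)
      _ = C * (1 / 2) ^ n := by
          rw [Finset.sum_const, Finset.card_range, nsmul_eq_mul, ENNReal.div_eq_inv_mul,
            ← mul_assoc, mul_comm]
          congr 1
          push_cast
          rw [show (4 : ℝ≥0∞) = 2 * 2 by norm_num, mul_pow, ENNReal.mul_inv (by simp) (by simp),
            ← mul_assoc, ENNReal.mul_inv_cancel (by simp) (by simp), one_mul, one_div,
            ENNReal.inv_pow]
  have hsum : ∑' n, P (bad n) ≠ ∞ := by
    refine ne_top_of_le_ne_top ?_ (ENNReal.tsum_le_tsum hbad)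
    rw [ENNReal.tsum_mul_left, ENNReal.tsum_geometric]
    exact ENNReal.mul_ne_top hC (by simp)
  filter_upwards [ae_eventually_notMem hsum] with ω hω
  obtain ⟨N, hN⟩ := eventually_atTop.1 hω
  refine ⟨N, fun n hn k hk => ?_⟩
  have := hN n hn
  simp only [bad, Set.mem_iUnion, not_exists, Finset.mem_range] at this
  exact not_lt.1 (this k hk)

/-- Paths are locally Hölder at `0` with every exponent `β < H`. -/
lemma ae_eventually_abs_sub_lt (hX : HasFractionalIncrements H X P) (hH : 0 < H) {β : ℝ}
    (hβ : β < H) : ∀ᵐ ω ∂P, ∀ᶠ t in 𝓝[>] (0 : ℝ), |X t ω - X 0 ω| < t ^ β := by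
  -- The maximum with `0` is needed because chaining requires `β' > 0`, while `β` may be negative.
  obtain ⟨β', h1, h2⟩ := exists_between (max_lt hβ hH)
  filter_upwards [hX.ae_exists_mem_smallDyadic h2, hX.continuous] with ω ⟨N, hN⟩ hc
  obtain ⟨δ, hδ, h⟩ := exists_abs_sub_lt_rpow_of_dyadic_increments (lt_of_le_of_lt
    (le_max_right _ _) h1) (lt_of_le_of_lt (le_max_left _ _) h1) N
  filter_upwards [Ioo_mem_nhdsGT hδ] with t ht
  exact h _ hc hN t ht.1 ht.2

/-- The local Hölder bound holds on a fixed interval with probability at least `1 / 2`. -/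
lemma exists_abs_sub_lt_of_half (hX : HasFractionalIncrements H X P) [IsProbabilityMeasure P]
    (hH : 0 < H) {β : ℝ} (hβ : β < H) :
    ∃ δ : ℝ, 0 < δ ∧ ∃ G : Set Ω, NullMeasurableSet G P ∧ 1 / 2 ≤ P G ∧
      ∀ᵐ ω ∂P, ω ∈ G → ∀ t, 0 < t → t < δ → |X t ω - X 0 ω| < t ^ β := by
  obtain ⟨β', h1, h2⟩ := exists_between (max_lt hβ hH)
  have hun : P (⋃ N, smallDyadic X β' N) = 1 := by
    rw [← measure_univ (μ := P)]
    refine measure_congr (eventuallyEq_univ.2 ?_)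
    filter_upwards [hX.ae_exists_mem_smallDyadic h2] with ω hω using Set.mem_iUnion.2 hω
  -- Continuity from below replaces the random starting generation by a fixed `N`, hence a nonrandom
  -- `δ`, at the cost of some probability.
  have hlim := tendsto_measure_iUnion_atTop (μ := P) (monotone_smallDyadic (X := X) β')
  rw [hun] at hlim
  obtain ⟨N, hN⟩ := (hlim.eventually (lt_mem_nhds (by simp : (1 / 2 : ℝ≥0∞) < 1))).exists
  obtain ⟨δ, hδ, h⟩ := exists_abs_sub_lt_rpow_of_dyadic_increments (lt_of_le_of_lt
    (le_max_right _ _) h1) (lt_of_le_of_lt (le_max_left _ _) h1) N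
  refine ⟨δ, hδ, _, hX.nullMeasurableSet_smallDyadic β' N, hN.le, ?_⟩
  filter_upwards [hX.continuous] with ω hc hω using h _ hc hω

/-- Along dyadic times, increments from `0` are eventually larger than any power `γ > H`. -/
lemma ae_eventually_lt_abs_sub (hX : HasFractionalIncrements H X P) {γ : ℝ} (hγ : H < γ) :
    ∀ᵐ ω ∂P, ∀ᶠ n : ℕ in atTop, ((2 : ℝ) ^ n)⁻¹ ^ γ < |X ((2 ^ n)⁻¹) ω - X 0 ω| := by
  set ρ : ℝ := (2 : ℝ) ^ (-(γ - H)) with hρ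
  have hρ1 : ρ < 1 := Real.rpow_lt_one_of_one_lt_of_neg (by norm_num) (by linarith)
  have hbad : ∀ n : ℕ, P {ω | |X ((2 ^ n)⁻¹) ω - X 0 ω| ≤ ((2 : ℝ) ^ n)⁻¹ ^ γ}
      ≤ 2 * ENNReal.ofReal ρ ^ n := by
    intro n
    have h := hX.measure_increment_mem (s := 0) (t := (2 ^ n)⁻¹) le_rfl (by positivity)
      (A := {x | |x| ≤ ((2 : ℝ) ^ n)⁻¹ ^ γ}) (measurableSet_le measurable_id.abs measurable_const)
    simp only [Set.mem_ofPred_eq] at h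
    rw [h]
    have e : {x : ℝ | |(|((2 : ℝ) ^ n)⁻¹ - 0| ^ H * x)| ≤ ((2 : ℝ) ^ n)⁻¹ ^ γ}
        = {x | |x| ≤ ρ ^ n} := by
      ext x
      have hpos : (0 : ℝ) < (2 ^ n)⁻¹ := by positivity
      have e1 : ((2 : ℝ) ^ n)⁻¹ ^ γ = ((2 : ℝ) ^ n)⁻¹ ^ H * ρ ^ n := by
        have : ρ ^ n = ((2 : ℝ) ^ n)⁻¹ ^ (γ - H) := by
          rw [hρ, Real.inv_rpow (by positivity), ← Real.rpow_natCast_mul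
            (by norm_num), mul_comm, Real.rpow_mul_natCast (by norm_num),
            Real.rpow_neg (by norm_num), inv_pow]
        rw [this, ← Real.rpow_add hpos]; congr 1; ring
      simp only [Set.mem_ofPred_eq]
      rw [sub_zero, abs_of_pos hpos, abs_mul, abs_of_pos (Real.rpow_pos_of_pos hpos H), e1]
      exact mul_le_mul_iff_right₀ (Real.rpow_pos_of_pos hpos H)
    rw [e]
    refine (gaussianReal_abs_le_le _).trans_eq ?_
    rw [ENNReal.ofReal_mul (by norm_num), ENNReal.ofReal_pow (by positivity)]
    simp
  have hsum : ∑' n : ℕ, P {ω | |X ((2 ^ n)⁻¹) ω - X 0 ω| ≤ ((2 : ℝ) ^ n)⁻¹ ^ γ} ≠ ∞ := by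
    refine ne_top_of_le_ne_top ?_ (ENNReal.tsum_le_tsum hbad)
    rw [ENNReal.tsum_mul_left, ENNReal.tsum_geometric]
    refine ENNReal.mul_ne_top (by simp) (ENNReal.inv_ne_top.2 ?_)
    rw [ne_eq, tsub_eq_zero_iff_le, not_le]
    simpa using hρ1
  filter_upwards [ae_eventually_notMem hsum] with ω hω
  filter_upwards [hω] with n hn
  simpa using hn

end HasFractionalIncrements

/-! ### Increments of fractional Brownian motion and of the Wiener process. -/

section Increments

variable {Ω : Type*} {mΩ : MeasurableSpace Ω} {P : Measure Ω}

/-- Increments are centered Gaussian, and the covariance formula gives variance `|u - v| ^ (2 * H)`.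
-/
lemma IsFractionalBrownian.hasLaw_sub {H : ℝ} {B : ℝ → Ω → ℝ} (hB : IsFractionalBrownian H B P)
    (hH : 0 < H) (u v : ℝ) :
    HasLaw (fun ω => B u ω - B v ω) ((gaussianReal 0 1).map fun x => |u - v| ^ H * x) P := by
  have := hB.isGaussianProcess.isProbabilityMeasure
  have hL : ∀ t, MemLp (B t) 2 P := fun t =>
    (hB.isGaussianProcess.hasGaussianLaw_eval t).memLp_two
  have hvar : ∀ t, Var[B t; P] = |t| ^ (2 * H) := by
    intro t
    rw [← covariance_self (hL t).aestronglyMeasurable.aemeasurable, hB.covariance, sub_self,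
      abs_zero, Real.zero_rpow (by positivity)]
    ring
  have hg : HasGaussianLaw (fun ω => B u ω - B v ω) P := hB.isGaussianProcess.hasGaussianLaw_fun_sub
  refine ⟨hg.aemeasurable, ?_⟩
  rw [hg.map_eq_gaussianReal, gaussianReal_map_const_mul, integral_sub
    ((hL u).integrable (by norm_num)) ((hL v).integrable (by norm_num)), hB.centered, hB.centered,
    variance_fun_sub (hL u) (hL v), hvar, hvar, hB.covariance, abs_sub_comm v u]
  congr 1
  · simp
  · ext
    rw [Real.coe_toNNReal _ (by have : 0 ≤ |u - v| ^ (2 * H) := by positivity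
                                linarith)]
    push_cast
    rw [mul_one, ← Real.rpow_mul_natCast (abs_nonneg _), Nat.cast_ofNat, mul_comm H]
    ring

/-- Together with its reflection below, this reduces both sides of `T` to one-sided estimates at
`0`. -/
lemma IsFractionalBrownian.hasFractionalIncrements_add {H : ℝ} {B : ℝ → Ω → ℝ}
    (hB : IsFractionalBrownian H B P) (hH : 0 < H) (T : ℝ) :
    HasFractionalIncrements H (fun t => B (T + t)) P where
  hasLaw s t _ _ := by simpa using hB.hasLaw_sub hH (T + t) (T + s)
  continuous := by
    filter_upwards [hB.continuous] with ω h using h.comp (by fun_prop)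

lemma IsFractionalBrownian.hasFractionalIncrements_sub {H : ℝ} {B : ℝ → Ω → ℝ}
    (hB : IsFractionalBrownian H B P) (hH : 0 < H) (T : ℝ) :
    HasFractionalIncrements H (fun t => B (T - t)) P where
  hasLaw s t _ _ := by simpa [abs_sub_comm s t] using hB.hasLaw_sub hH (T - t) (T - s)
  continuous := by
    filter_upwards [hB.continuous] with ω h using h.comp (by fun_prop)

variable {T : ℝ} {W : ℝ≥0 → Ω → ℝ}

lemma IsWienerFrom.hasLaw_sub (hW : IsWienerFrom T W P) (s t : ℝ≥0) :
    HasLaw (fun ω => W t ω - W s ω) (gaussianReal 0 (nndist (t : ℝ) s)) P := by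
  have h := hW.toIsPreBrownianReal.hasLaw_sub t s
  refine h.congr (Eventually.of_forall fun ω => ?_)
  simp

lemma IsWienerFrom.continuous (hW : IsWienerFrom T W P) :
    ∀ᵐ ω ∂P, Continuous fun s => W s ω := by
  filter_upwards [hW.cont] with ω h
  simpa using h.add_const T

lemma IsWienerFrom.zero (hW : IsWienerFrom T W P) : ∀ᵐ ω ∂P, W 0 ω = T := by
  filter_upwards [hW.toIsPreBrownianReal.eval_zero_ae_eq_zero] with ω h using sub_eq_zero.1 h

lemma IsWienerFrom.hasFractionalIncrements (hW : IsWienerFrom T W P) :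
    HasFractionalIncrements (1 / 2) (fun t => W t.toNNReal) P where
  hasLaw s t hs ht := by
    convert hW.hasLaw_sub s.toNNReal t.toNNReal using 1
    rw [gaussianReal_map_const_mul]
    congr 1
    · simp
    · ext
      push_cast
      rw [Real.coe_toNNReal _ hs, Real.coe_toNNReal _ ht, mul_one,
        ← Real.rpow_mul_natCast (abs_nonneg _), Real.dist_eq]
      norm_num
  continuous := by
    filter_upwards [hW.continuous] with ω h using h.comp continuous_real_toNNReal

end Increments

/-! ### Mean exit times of the Wiener process. -/

section ExitTime

variable {Ω X : Type*} {mΩ : MeasurableSpace Ω} {P : Measure Ω} {T : ℝ} {W : ℝ≥0 → Ω → ℝ}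

/-- If staying within distance `c` of the starting point keeps `M` in `U`, the mean exit time is
at least of order `c ^ (1 / β)`, for every `β < 1 / 2`. -/
lemma IsWienerFrom.exists_le_lintegral_exitTime [IsProbabilityMeasure P] (hW : IsWienerFrom T W P)
    {β : ℝ} (hβ0 : 0 < β) (hβ : β < 1 / 2) :
    ∃ c₀ : ℝ, 0 < c₀ ∧ ∀ c, 0 < c → c ≤ c₀ → ∀ (M : ℝ≥0 → Ω → X) (U : Set X),
      (∀ s ω, |W s ω - T| < c → M s ω ∈ U) →
      ENNReal.ofReal (c ^ (1 / β)) * (1 / 2) ≤ ∫⁻ ω, exitTime M U ω ∂P := by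
  obtain ⟨δ, hδ, G, hG, hPG, h⟩ :=
    hW.hasFractionalIncrements.exists_abs_sub_lt_of_half (by norm_num) hβ
  refine ⟨δ ^ β, by positivity, fun c hc hcδ M U hMU => ?_⟩
  -- Up to time `c ^ (1 / β)` the Hölder bound applies and keeps `|W - T|` below `c`.
  have hle : c ^ (1 / β) ≤ δ := by
    calc c ^ (1 / β) ≤ (δ ^ β) ^ (1 / β) := by gcongr
      _ = δ := by rw [← Real.rpow_mul hδ.le, mul_one_div_cancel hβ0.ne', Real.rpow_one]
  have hae : ∀ᵐ ω ∂P, ω ∈ G → ENNReal.ofReal (c ^ (1 / β)) ≤ exitTime M U ω := by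
    filter_upwards [h, hW.zero] with ω hω h0 hωG
    refine le_iInf₂ fun s hs => ?_
    rw [ENNReal.ofReal_le_iff_le_toReal ENNReal.coe_ne_top, ENNReal.coe_toReal]
    by_contra! hlt
    refine hs (hMU s ω ?_)
    rcases eq_or_lt_of_le (zero_le (a := s)) with rfl | hs0
    · simpa [h0] using hc
    have h1 := hω hωG s (by exact_mod_cast hs0) (hlt.trans_le hle)
    simp only [Real.toNNReal_coe, Real.toNNReal_zero, h0] at h1
    calc |W s ω - T| < (s : ℝ) ^ β := h1
      _ ≤ (c ^ (1 / β)) ^ β := by gcongr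
      _ = c := by rw [← Real.rpow_mul hc.le, one_div_mul_cancel hβ0.ne', Real.rpow_one]
  calc ENNReal.ofReal (c ^ (1 / β)) * (1 / 2) ≤ ENNReal.ofReal (c ^ (1 / β)) * P G := by gcongr
    _ = ∫⁻ _ in G, ENNReal.ofReal (c ^ (1 / β)) ∂P := by rw [setLIntegral_const]
    _ ≤ ∫⁻ ω in G, exitTime M U ω ∂P := lintegral_mono_ae ((ae_restrict_iff'₀ hG).2 hae)
    _ ≤ ∫⁻ ω, exitTime M U ω ∂P := lintegral_mono' Measure.restrict_le_self le_rfl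

/-- Strictness is what makes the geometric series for the mean exit time converge. -/
lemma gaussianReal_abs_le_lt_one (a : ℝ) : gaussianReal 0 1 {x | |x| ≤ a} < 1 := by
  have hm : MeasurableSet {x : ℝ | |x| ≤ a} := measurableSet_le measurable_id.abs measurable_const
  refine lt_of_le_of_ne prob_le_one fun h => ?_
  rw [← prob_compl_eq_zero_iff hm] at h
  have h0 := gaussianReal_absolutelyContinuous' 0 one_ne_zero h
  have hsub : Set.Ioo |a| (|a| + 1) ⊆ {x : ℝ | |x| ≤ a}ᶜ := fun x hx => by
    have := le_abs_self a
    have := le_abs_self x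
    simp only [Set.mem_compl_iff, Set.mem_ofPred_eq, not_le]
    linarith [hx.1]
  have := measure_mono_null hsub h0
  simp at this

/-- Increments over steps of length `c ^ 2` are independent with standard deviation `c`, so the base
of the power does not depend on `c`. -/
lemma IsWienerFrom.measure_forall_increment_le (hW : IsWienerFrom T W P) {c : ℝ≥0} (hc : 0 < c)
    (n : ℕ) :
    P {ω | ∀ k < n, |W ((k + 1 : ℕ) * c ^ 2) ω - W ((k : ℕ) * c ^ 2) ω| ≤ 2 * c}
      = gaussianReal 0 1 {x | |x| ≤ 2} ^ n := by
  have hmono : Monotone fun k : ℕ => (k : ℝ≥0) * c ^ 2 := fun a b h => by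
    dsimp only; gcongr
  have hind := hW.toIsPreBrownianReal.hasIndepIncrements.nat hmono
  have hm : MeasurableSet {x : ℝ | |x| ≤ 2 * c} :=
    measurableSet_le measurable_id.abs measurable_const
  have h := iIndepFun_iff_measure_inter_preimage_eq_mul.1 hind (Finset.range n)
    (sets := fun _ => {x : ℝ | |x| ≤ 2 * c}) (fun _ _ => hm)
  have hfac : ∀ k : ℕ, P {ω | |W ((k + 1 : ℕ) * c ^ 2) ω - W ((k : ℕ) * c ^ 2) ω| ≤ 2 * c}
      = gaussianReal 0 1 {x | |x| ≤ 2} := by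
    intro k
    have hl := hW.hasFractionalIncrements.measure_increment_mem
      (s := ((k : ℕ) * c ^ 2 : ℝ≥0)) (t := ((k + 1 : ℕ) * c ^ 2 : ℝ≥0)) (by positivity)
      (by positivity) hm
    simp only [Real.toNNReal_coe, Set.mem_ofPred_eq] at hl
    rw [hl]
    congr 1
    ext x
    have hc' : (0 : ℝ) < c := by exact_mod_cast hc
    have e : (((k + 1 : ℕ) * c ^ 2 : ℝ≥0) : ℝ) - ((k : ℕ) * c ^ 2 : ℝ≥0) = (c : ℝ) ^ 2 := by
      push_cast; ring
    have e2 : |(c : ℝ) ^ 2| ^ (1 / 2 : ℝ) = c := by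
      rw [abs_of_nonneg (by positivity), ← Real.sqrt_eq_rpow, Real.sqrt_sq hc'.le]
    simp only [Set.mem_ofPred_eq]
    rw [e, e2, abs_mul, abs_of_pos hc', mul_comm 2]
    exact mul_le_mul_iff_right₀ hc'
  calc _ = P (⋂ k ∈ Finset.range n, {ω | |W ((k + 1 : ℕ) * c ^ 2) ω
          - W ((k : ℕ) * c ^ 2) ω| ≤ 2 * c}) := by
        congr 1; ext ω; simp
    _ = ∏ k ∈ Finset.range n, P {ω | |W ((k + 1 : ℕ) * c ^ 2) ω
          - W ((k : ℕ) * c ^ 2) ω| ≤ 2 * c} := by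
        simpa [Set.preimage] using h
    _ = _ := by rw [Finset.prod_congr rfl fun k _ => hfac k, Finset.prod_const, Finset.card_range]

/-- If `M` has left `U` as soon as `W` has moved by `c`, the mean exit time is `O(c ^ 2)`. -/
lemma IsWienerFrom.lintegral_exitTime_le (hW : IsWienerFrom T W P) {c : ℝ≥0} (hc : 0 < c)
    (M : ℝ≥0 → Ω → X) (U : Set X)
    (hMU : ∀ᵐ ω ∂P, ∀ s, c ≤ |W s ω - T| → ∃ s' ≤ s, M s' ω ∉ U) :
    ∫⁻ ω, exitTime M U ω ∂P ≤ c ^ 2 * (1 - gaussianReal 0 1 {x | |x| ≤ 2})⁻¹ := by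
  set A : ℕ → Set Ω := fun n =>
    {ω | ∀ k < n, |W ((k + 1 : ℕ) * c ^ 2) ω - W ((k : ℕ) * c ^ 2) ω| ≤ 2 * c} with hA
  have hAm : ∀ n, NullMeasurableSet (A n) P := by
    intro n
    simp only [hA, Set.ofPred_forall]
    refine .iInter fun k => .iInter fun _ => ?_
    exact nullMeasurableSet_le (hW.hasLaw_sub _ _).aemeasurable.abs aemeasurable_const
  have hc2 : (c ^ 2 : ℝ≥0∞) ≠ 0 := by simpa using hc.ne'
  -- An increment larger than `2 * c` has an endpoint at distance at least `c` from `T`. If the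
  -- first one has index `n`, then `A 0, …, A n` all hold and exit occurs by time `(n + 1) * c ^ 2`;
  -- if there is none, the series is infinite.
  have hle : ∀ᵐ ω ∂P, exitTime M U ω ≤ ∑' n, (A n).indicator (fun _ => (c ^ 2 : ℝ≥0∞)) ω := by
    filter_upwards [hMU] with ω hω
    by_cases hex : ∃ k : ℕ, 2 * c < |W ((k + 1 : ℕ) * c ^ 2) ω - W ((k : ℕ) * c ^ 2) ω|
    · classical
      set n := Nat.find hex with hn
      have hn1 := Nat.find_spec hex
      rw [← hn] at hn1
      have hmem : ∀ j ∈ Finset.range (n + 1),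
          (A j).indicator (fun _ => (c ^ 2 : ℝ≥0∞)) ω = c ^ 2 := by
        intro j hj
        refine Set.indicator_of_mem (s := A j) ?_ _
        exact fun k hk => not_lt.1 (Nat.find_min hex (by
          have := Finset.mem_range.1 hj; omega))
      have hexit : ∃ s : ℝ≥0, s ≤ (n + 1 : ℕ) * c ^ 2 ∧ M s ω ∉ U := by
        have hor : c ≤ |W ((n + 1 : ℕ) * c ^ 2) ω - T| ∨ c ≤ |W ((n : ℕ) * c ^ 2) ω - T| := by
          by_contra! hcon
          have := abs_sub_le (W ((n + 1 : ℕ) * c ^ 2) ω) T (W ((n : ℕ) * c ^ 2) ω)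
          rw [abs_sub_comm T] at this
          linarith [hcon.1, hcon.2]
        rcases hor with hor | hor
        · exact hω _ hor
        · obtain ⟨s, hs, hsU⟩ := hω _ hor
          refine ⟨s, hs.trans ?_, hsU⟩
          gcongr
          omega
      obtain ⟨s, hs, hsU⟩ := hexit
      calc exitTime M U ω ≤ (s : ℝ≥0∞) := iInf₂_le s hsU
        _ ≤ (((n + 1 : ℕ) * c ^ 2 : ℝ≥0) : ℝ≥0∞) := by exact_mod_cast hs
        _ = ∑ j ∈ Finset.range (n + 1), (A j).indicator (fun _ => (c ^ 2 : ℝ≥0∞)) ω := by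
          rw [Finset.sum_congr rfl hmem]; simp
        _ ≤ _ := ENNReal.sum_le_tsum _
    · push Not at hex
      have : ∀ n, (A n).indicator (fun _ => (c ^ 2 : ℝ≥0∞)) ω = c ^ 2 := fun n =>
        Set.indicator_of_mem (s := A n) (fun k _ => hex k) _
      simp_rw [this]
      rw [ENNReal.tsum_const_eq_top_of_ne_zero hc2]
      exact le_top
  calc ∫⁻ ω, exitTime M U ω ∂P
      ≤ ∫⁻ ω, ∑' n, (A n).indicator (fun _ => (c ^ 2 : ℝ≥0∞)) ω ∂P := lintegral_mono_ae hle
    _ = ∑' n, ∫⁻ ω, (A n).indicator (fun _ => (c ^ 2 : ℝ≥0∞)) ω ∂P :=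
        lintegral_tsum fun n => aemeasurable_const.indicator₀ (hAm n)
    _ = ∑' n, (c ^ 2 : ℝ≥0∞) * gaussianReal 0 1 {x | |x| ≤ 2} ^ n := by
        congr with n
        rw [lintegral_indicator_const₀ (hAm n), hA, hW.measure_forall_increment_le hc]
    _ = _ := by rw [ENNReal.tsum_mul_left, ENNReal.tsum_geometric]

end ExitTime

/-! ### From power bounds to logarithmic order. -/

lemma eventually_const_mul_rpow_le (C : ℝ) {x y : ℝ} (h : x < y) :
    ∀ᶠ r in 𝓝[>] (0 : ℝ), C * r ^ y ≤ r ^ x := by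
  have hlim : Tendsto (fun t : ℝ => C * t ^ (y - x)) (𝓝[>] 0) (𝓝 0) := by
    simpa using ((tendsto_rpow_nhdsGT_zero (sub_pos.2 h)).mono_right
      nhdsWithin_le_nhds).const_mul C
  filter_upwards [hlim.eventually (gt_mem_nhds one_pos), self_mem_nhdsWithin] with r hr hr0
  have hr0 : 0 < r := hr0
  calc C * r ^ y = C * r ^ (y - x) * r ^ x := by
        rw [mul_assoc, ← Real.rpow_add hr0, sub_add_cancel]
    _ ≤ 1 * r ^ x := by gcongr
    _ = r ^ x := one_mul _

/-- Squeezing between powers determines the logarithmic order at `0`. -/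
lemma tendsto_ennrealLog_div_log {E : ℝ → ℝ≥0∞} {d : ℝ}
    (hup : ∀ a < d, ∀ᶠ r in 𝓝[>] (0 : ℝ), E r ≤ ENNReal.ofReal (r ^ a))
    (hlo : ∀ b > d, ∀ᶠ r in 𝓝[>] (0 : ℝ), ENNReal.ofReal (r ^ b) ≤ E r) :
    Tendsto (fun r : ℝ => ENNReal.log (E r) / (Real.log r : EReal)) (𝓝[>] 0) (𝓝 (d : EReal)) := by
  have hmem : ∀ᶠ r in 𝓝[>] (0 : ℝ), r ∈ Set.Ioo (0 : ℝ) 1 := Ioo_mem_nhdsGT one_pos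
  have key : Tendsto (fun r : ℝ => Real.log (E r).toReal / Real.log r) (𝓝[>] 0) (𝓝 d) := by
    rw [tendsto_order]
    constructor
    · intro a ha
      obtain ⟨a', h1, h2⟩ := exists_between ha
      -- The exponent `d + 1` only ensures `E r ≠ 0`; in the other half `d - 1` only ensures
      -- finiteness. Inequalities flip on division by `log r < 0`.
      filter_upwards [hmem, hup a' h2, hlo (d + 1) (by linarith)] with r hr hu hl
      have hpos : 0 < (E r).toReal := ENNReal.toReal_pos
        (ne_of_gt (lt_of_lt_of_le (by simpa using Real.rpow_pos_of_pos hr.1 _) hl))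
        (ne_top_of_le_ne_top ENNReal.ofReal_ne_top hu)
      have hle : (E r).toReal ≤ r ^ a' := ENNReal.toReal_le_of_le_ofReal
        (Real.rpow_pos_of_pos hr.1 _).le hu
      have hlog : Real.log r < 0 := Real.log_neg hr.1 hr.2
      refine h1.trans_le ?_
      rw [le_div_iff_of_neg hlog, ← Real.log_rpow hr.1]
      exact Real.log_le_log hpos hle
    · intro b hb
      obtain ⟨b', h1, h2⟩ := exists_between hb
      filter_upwards [hmem, hlo b' h1, hup (d - 1) (by linarith)] with r hr hl hu
      have hle : r ^ b' ≤ (E r).toReal :=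
        (ENNReal.ofReal_le_iff_le_toReal (ne_top_of_le_ne_top ENNReal.ofReal_ne_top hu)).1 hl
      have hlog : Real.log r < 0 := Real.log_neg hr.1 hr.2
      refine lt_of_le_of_lt ?_ h2
      rw [div_le_iff_of_neg hlog, ← Real.log_rpow hr.1]
      exact Real.log_le_log (Real.rpow_pos_of_pos hr.1 _) hle
  have hE := (continuous_coe_real_ereal.tendsto d).comp key
  refine hE.congr' ?_
  filter_upwards [hmem, hlo (d + 1) (by linarith), hup (d - 1) (by linarith)] with r hr hl hu
  have h0 : E r ≠ 0 := ne_of_gt (lt_of_lt_of_le (by simpa using Real.rpow_pos_of_pos hr.1 _) hl)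
  rw [ENNReal.log_pos_real h0 (ne_top_of_le_ne_top ENNReal.ofReal_ne_top hu), Function.comp_apply,
    EReal.coe_div]

lemma toGraph_mem_ball {f : ℝ → ℝ} {x T r : ℝ} :
    toGraph f x ∈ Metric.ball (toGraph f T) r ↔ |x - T| < r ∧ |f x - f T| < r := by
  rw [Metric.mem_ball, Subtype.dist_eq, Prod.dist_eq, max_lt_iff]
  simp [toGraph, Real.dist_eq]

/-! ### Exit times of the walk on the graph of a fixed function. -/

section Walk

variable {Ω : Type*} {mΩ : MeasurableSpace Ω} {P : Measure Ω} {T : ℝ} {W : ℝ≥0 → Ω → ℝ}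
  {f : ℝ → ℝ}

/-- Hölder bounds on `f` at `T` give a lower bound for mean exit times. -/
lemma IsWienerFrom.eventually_le_lintegral_exitTime_graph [IsProbabilityMeasure P]
    (hW : IsWienerFrom T W P) {β β' b : ℝ} (hβ0 : 0 < β) (hβ1 : β < 1)
    (hβ'0 : 0 < β') (hβ' : β' < 1 / 2) (hb : 1 / β * (1 / β') < b)
    (hadd : ∀ᶠ t in 𝓝[>] (0 : ℝ), |f (T + t) - f T| < t ^ β)
    (hsub : ∀ᶠ t in 𝓝[>] (0 : ℝ), |f (T - t) - f T| < t ^ β) :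
    ∀ᶠ r in 𝓝[>] (0 : ℝ), ENNReal.ofReal (r ^ b) ≤
      ∫⁻ ω, exitTime (fun s ω' => toGraph f (W s ω')) (Metric.ball (toGraph f T) r) ω ∂P := by
  obtain ⟨c₀, hc₀, hexit⟩ := hW.exists_le_lintegral_exitTime (X := FunGraph f) hβ'0 hβ'
  obtain ⟨δ, hδ, hδs⟩ := mem_nhdsGT_iff_exists_Ioo_subset.1 (hadd.and hsub)
  have hpow := tendsto_rpow_nhdsGT_zero (one_div_pos.2 hβ0)
  filter_upwards [Ioo_mem_nhdsGT one_pos, eventually_const_mul_rpow_le 2 hb,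
    hpow.eventually (Ioo_mem_nhdsGT hc₀), hpow.eventually (Ioo_mem_nhdsGT hδ)] with r hr h2 hrc hrδ
  have hrpos : 0 < r := hr.1
  refine le_trans ?_ (hexit (r ^ (1 / β)) hrc.1 hrc.2.le _ _ ?_)
  · rw [← Real.rpow_mul hrpos.le, one_div (2 : ℝ≥0∞), ← div_eq_mul_inv,
      ENNReal.le_div_iff_mul_le (by simp) (by simp), mul_comm]
    calc (2 : ℝ≥0∞) * ENNReal.ofReal (r ^ b) = ENNReal.ofReal (2 * r ^ b) := by
          rw [ENNReal.ofReal_mul (by norm_num)]; simp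
      _ ≤ _ := ENNReal.ofReal_le_ofReal h2
  · intro s ω hs
    rw [toGraph_mem_ball]
    constructor
    -- Since `β < 1` and `r < 1`, `r ^ (1 / β) ≤ r`, so the horizontal coordinate imposes no further
    -- constraint.
    · refine hs.trans_le ?_
      calc r ^ (1 / β) ≤ r ^ (1 : ℝ) :=
            Real.rpow_le_rpow_of_exponent_ge hrpos hr.2.le ((one_le_div hβ0).2 hβ1.le)
        _ = r := Real.rpow_one r
    · set x := W s ω
      have hlt : |x - T| ^ β < r := by
        calc |x - T| ^ β < (r ^ (1 / β)) ^ β := Real.rpow_lt_rpow (abs_nonneg _) hs hβ0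
          _ = r := by rw [← Real.rpow_mul hrpos.le, one_div_mul_cancel hβ0.ne', Real.rpow_one]
      rcases lt_trichotomy x T with hx | hx | hx
      · have e : |x - T| = T - x := by rw [abs_of_neg (by linarith)]; ring
        have := (hδs (⟨by linarith, by rw [← e]; exact hs.trans hrδ.2⟩ :
          T - x ∈ Set.Ioo 0 δ)).2
        rw [sub_sub_cancel] at this
        rw [e] at hlt
        exact this.trans hlt
      · simpa [hx] using hrpos
      · have e : |x - T| = x - T := abs_of_pos (by linarith)
        have := (hδs (⟨by linarith, by rw [← e]; exact hs.trans hrδ.2⟩ :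
          x - T ∈ Set.Ioo 0 δ)).1
        rw [add_sub_cancel] at this
        rw [e] at hlt
        exact this.trans hlt

/-- Oscillation of `f` at dyadic distances from `T` gives an upper bound for mean exit times. -/
lemma IsWienerFrom.eventually_lintegral_exitTime_graph_le
    (hW : IsWienerFrom T W P) {γ a : ℝ} (hγ : 0 < γ) (ha : a < 2 / γ)
    (hadd : ∀ᶠ n : ℕ in atTop, ((2 : ℝ) ^ n)⁻¹ ^ γ < |f (T + (2 ^ n)⁻¹) - f T|)
    (hsub : ∀ᶠ n : ℕ in atTop, ((2 : ℝ) ^ n)⁻¹ ^ γ < |f (T - (2 ^ n)⁻¹) - f T|) :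
    ∀ᶠ r in 𝓝[>] (0 : ℝ),
      ∫⁻ ω, exitTime (fun s ω' => toGraph f (W s ω')) (Metric.ball (toGraph f T) r) ω ∂P
        ≤ ENNReal.ofReal (r ^ a) := by
  set K : ℝ≥0∞ := (1 - gaussianReal 0 1 {x | |x| ≤ 2})⁻¹ with hK
  have hKtop : K ≠ ∞ := by
    rw [hK, ENNReal.inv_ne_top, ne_eq, tsub_eq_zero_iff_le, not_le]
    exact gaussianReal_abs_le_lt_one 2
  obtain ⟨N, hN⟩ := eventually_atTop.1 (hadd.and hsub)
  have hpow := tendsto_rpow_nhdsGT_zero (one_div_pos.2 hγ)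
  filter_upwards [self_mem_nhdsWithin, eventually_const_mul_rpow_le (4 * K.toReal) ha,
    hpow.eventually (Ioo_mem_nhdsGT (by positivity : (0 : ℝ) < (1 / 2) ^ N))] with r hr h4 hrN
  have hr : 0 < r := hr
  -- Choose `2⁻⁽ⁿ⁺¹⁾ < r ^ (1 / γ) ≤ 2⁻ⁿ`: the upper bound makes the displacement of `f` at `T ±
  -- 2⁻ⁿ` exceed `r`, and the lower one gives the factor `4 = 2 ^ 2` in `hc2`.
  obtain ⟨n, hn1, hn2⟩ := exists_nat_pow_near_of_lt_one hrN.1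
    (hrN.2.le.trans (pow_le_one₀ (by norm_num) (by norm_num)))
    (by norm_num : (0 : ℝ) < 1 / 2) (by norm_num)
  have hNn : N < n + 1 :=
    (pow_lt_pow_iff_right_of_lt_one₀ (by norm_num) (by norm_num)).1 (hn1.trans hrN.2)
  obtain ⟨hnadd, hnsub⟩ := hN n (by omega)
  have hinv : ((2 : ℝ) ^ n)⁻¹ = (1 / 2) ^ n := by rw [one_div, inv_pow]
  rw [hinv] at hnadd hnsub
  have hrγ : r ≤ ((1 / 2 : ℝ) ^ n) ^ γ := by
    calc r = (r ^ (1 / γ)) ^ γ := by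
          rw [← Real.rpow_mul hr.le, one_div_mul_cancel hγ.ne', Real.rpow_one]
      _ ≤ _ := by gcongr
  set c : ℝ≥0 := (1 / 2) ^ n with hc
  have hcr : (c : ℝ) = (1 / 2) ^ n := by rw [hc]; push_cast; rfl
  have hc2 : (c : ℝ) ^ 2 ≤ 4 * r ^ (2 / γ) := by
    have h : (c : ℝ) ≤ 2 * r ^ (1 / γ) := by rw [hcr]; rw [pow_succ] at hn1; linarith
    calc (c : ℝ) ^ 2 ≤ (2 * r ^ (1 / γ)) ^ 2 := by gcongr
      _ = 4 * r ^ (2 / γ) := by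
        rw [mul_pow, ← Real.rpow_mul_natCast hr.le]
        norm_num
        congr 1
        ring
  refine (hW.lintegral_exitTime_le (c := c) (by positivity) _ _ ?_).trans ?_
  · filter_upwards [hW.continuous, hW.zero] with ω hcont h0 s hs
    -- Since `f` is controlled only at `T ± c`, the intermediate value theorem is used to find a
    -- time `u ≤ s` with `|W - T|` exactly `c`.
    have hg : ContinuousOn (fun u => |W u ω - T|) (Set.Icc 0 s) :=
      ((hcont.sub continuous_const).abs).continuousOn
    obtain ⟨u, hu, hu'⟩ := intermediate_value_Icc (zero_le (a := s)) hg
      (⟨by simp [h0], hs⟩ : (c : ℝ) ∈ Set.Icc |W 0 ω - T| |W s ω - T|)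
    refine ⟨u, hu.2, fun hmem => ?_⟩
    rw [toGraph_mem_ball] at hmem
    dsimp only at hu'
    rcases abs_choice (W u ω - T) with h | h
    · have e : W u ω = T + (1 / 2) ^ n := by rw [← hcr, ← hu', h]; ring
      rw [e] at hmem
      linarith [hmem.2]
    · have e : W u ω = T - (1 / 2) ^ n := by rw [← hcr, ← hu', h]; ring
      rw [e] at hmem
      linarith [hmem.2]
  · calc (c : ℝ≥0∞) ^ 2 * K = ENNReal.ofReal ((c : ℝ) ^ 2 * K.toReal) := by
          rw [ENNReal.ofReal_mul (by positivity), ENNReal.ofReal_toReal hKtop,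
            ENNReal.ofReal_pow c.coe_nonneg, ENNReal.ofReal_coe_nnreal]
      _ ≤ ENNReal.ofReal (r ^ a) := by
          refine ENNReal.ofReal_le_ofReal (le_trans ?_ h4)
          have := mul_le_mul_of_nonneg_right hc2 (ENNReal.toReal_nonneg (a := K))
          linarith

end Walk

/-! ### Assembly of the two bounds. -/

/-- For almost every `ω`, the path `B · ω` is frozen and `W` runs on its graph: the exit times of
`φ_ω(W)` are averaged over `W` alone, whose law is unaffected since `W` is independent of `B`. -/
theorem mainTheorem5 {Ω : Type*} [MeasurableSpace Ω] (P : Measure Ω) [IsProbabilityMeasure P]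
    (H : ℝ) (hH0 : 0 < H) (hH1 : H < 1) (T : ℝ)
    (B : ℝ → Ω → ℝ) (hB : IsFractionalBrownian H B P)
    (W : ℝ≥0 → Ω → ℝ) (hW : IsWienerFrom T W P)
    (hBW : IndepFun (fun ω t => B t ω) (fun ω s => W s ω) P) :
    ∀ᵐ ω ∂P, HasLocalWalkDim (fun s ω' => toGraph (fun t => B t ω) (W s ω')) P
      (toGraph (fun t => B t ω) T) (2 / H) := by
  have hadd := hB.hasFractionalIncrements_add hH0 T
  have hsub := hB.hasFractionalIncrements_sub hH0 T
  -- Rational exponents allow a single null set to serve all exponents.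
  have hβ : ∀ᵐ ω ∂P, ∀ β : ℚ, (β : ℝ) < H →
      (∀ᶠ t in 𝓝[>] (0 : ℝ), |B (T + t) ω - B T ω| < t ^ (β : ℝ)) ∧
      (∀ᶠ t in 𝓝[>] (0 : ℝ), |B (T - t) ω - B T ω| < t ^ (β : ℝ)) := by
    refine ae_all_iff.2 fun β => ?_
    by_cases h : (β : ℝ) < H
    · filter_upwards [hadd.ae_eventually_abs_sub_lt hH0 h, hsub.ae_eventually_abs_sub_lt hH0 h]
        with ω h1 h2 _
      simp only [add_zero] at h1
      simp only [sub_zero] at h2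
      exact ⟨h1, h2⟩
    · exact Eventually.of_forall fun _ h' => absurd h' h
  have hγ : ∀ᵐ ω ∂P, ∀ γ : ℚ, H < (γ : ℝ) →
      (∀ᶠ n : ℕ in atTop, ((2 : ℝ) ^ n)⁻¹ ^ (γ : ℝ) < |B (T + (2 ^ n)⁻¹) ω - B T ω|) ∧
      (∀ᶠ n : ℕ in atTop, ((2 : ℝ) ^ n)⁻¹ ^ (γ : ℝ) < |B (T - (2 ^ n)⁻¹) ω - B T ω|) := by
    refine ae_all_iff.2 fun γ => ?_
    by_cases h : H < (γ : ℝ)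
    · filter_upwards [hadd.ae_eventually_lt_abs_sub h, hsub.ae_eventually_lt_abs_sub h]
        with ω h1 h2 _
      simp only [add_zero] at h1
      simp only [sub_zero] at h2
      exact ⟨h1, h2⟩
    · exact Eventually.of_forall fun _ h' => absurd h' h
  filter_upwards [hβ, hγ] with ω hβ hγ
  refine ⟨by filter_upwards [hW.zero] with ω' h; rw [h], tendsto_ennrealLog_div_log ?_ ?_⟩
  · intro a ha
    obtain ⟨γ, hHγ, haγ⟩ : ∃ γ : ℚ, H < (γ : ℝ) ∧ a < 2 / (γ : ℝ) := by
      -- For `a > 0` the condition is `γ < 2 / a`; for `a ≤ 0` every `γ > H` works.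
      rcases le_or_gt a 0 with h | h
      · obtain ⟨γ, hγ⟩ := exists_rat_gt H
        exact ⟨γ, hγ, h.trans_lt (div_pos two_pos (hH0.trans hγ))⟩
      · obtain ⟨γ, h1, h2⟩ := exists_rat_btwn ((lt_div_comm₀ h hH0).1 ha)
        exact ⟨γ, h1, (lt_div_comm₀ (hH0.trans h1) h).1 h2⟩
    exact hW.eventually_lintegral_exitTime_graph_le (hH0.trans hHγ) haγ (hγ γ hHγ).1 (hγ γ hHγ).2
  · intro b hb
    have hb0 : 0 < b := lt_trans (by positivity) hb
    -- From `b > 2 / H`, choose `β' < 1 / 2` and then `β < H` so close to these limits that `b * β *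
    -- β' > 1`.
    obtain ⟨β', h1, h2⟩ := exists_between (show 1 / (b * H) < 1 / 2 by
      rw [gt_iff_lt, div_lt_iff₀ hH0] at hb
      exact one_div_lt_one_div_of_lt two_pos hb)
    have hβ'0 : 0 < β' := lt_trans (by positivity) h1
    obtain ⟨β, h3, h4⟩ := exists_rat_btwn (show 1 / (b * β') < H by
      rw [div_lt_iff₀ (by positivity)] at h1 ⊢; linarith)
    have hβ0 : 0 < (β : ℝ) := lt_trans (by positivity) h3
    refine hW.eventually_le_lintegral_exitTime_graph hβ0 (h4.trans hH1) hβ'0 h2 ?_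
      (hβ β h4).1 (hβ β h4).2
    rw [div_lt_iff₀ (by positivity)] at h3
    rw [one_div_mul_one_div, div_lt_iff₀ (by positivity)]
    linarith
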